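/- Let $L$ be a first-order language and let $\mathcal U$ be a saturated $L$-structure whose cardinality $\kappa$ is (uncountable) inaccessible, Ramsey, and larger than $|L|$. Let $A\subseteq\mathcal U$ with $|A|<\kappa$, let $n<\omega$, and let $\mathcal D\subseteq\mathcal U^n$ be an arbitrary set. For $\mathcal S\subseteq\mathcal U^m$ write $\langle\mathcal U,\mathcal S\rangle$ for the expansion of $\mathcal U$ by an $m$-ary predicate for $\mathcal S$, and let $$e(\mathcal S)=\{\mathcal C\subseteq\mathcal U^m : \langle\mathcal U,\mathcal C\rangle\equiv\langle\mathcal U,\mathcal S\rangle\}.$$ A set $u\subseteq\mathcal P(\mathcal U^m)$ shatters $B\subseteq\mathcal U^m$ if every $H\subseteq B$ is of the form $\mathcal C\cap B$ with $\mathcal C\in u$; it has finite VC-dimension if for some $N<\omega$ no set of size $N$ is shattered by $u$. Let $\mathrm{Aut}(\mathcal U/A)$ be the group of automorphisms of $\mathcal U$ fixing $A$ pointwise. A set $\mathcal S\subseteq\mathcal U^m$ is invariant over $A$ if $f[\mathcal S]=\mathcal S$ for every $f\in\mathrm{Aut}(\mathcal U/A)$; it is Lascar invariant over $A$ if it is invariant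 over every elementary substructure $M\preceq\mathcal U$ with $A\subseteq M$ and $|M|<\kappa$. For $b\in\mathcal U^m$ let $o(b/A)=\{f(b):f\in\mathrm{Aut}(\mathcal U/A)\}$. A set $u\subseteq\mathcal P(\mathcal U^m)$ locally covers $\mathcal B\subseteq\mathcal U^m$ if for every $\mathcal K\subseteq\mathcal B$ of cardinality $\kappa$ and every $k<\omega$ there is $\mathcal C\in u$ with $|\mathcal K\cap\mathcal C|\ge k$. A set $\mathcal S\subseteq\mathcal U^m$ is pseudo-invariant over $A$ if $e(\mathcal S)$ locally covers $o(b/A)$ for every $b\in\mathcal S$. Suppose that $e(\mathcal D)$ has finite VC-dimension. Then the following are equivalent: 1. $\mathcal D$ is Lascar invariant over $A$; 2. for every $m<\omega$, every set $\mathcal S\subseteq\mathcal U^m$ that is definable in $\langle\mathcal U,\mathcal D\rangle$ with parameters from $A$ is pseudo-invariant over $A$; 3. $\mathcal D\times\neg\mathcal D=\{(a,b)\in\mathcal U^n\times\mathcal U^n : a\in\mathcal D,\ b\notin\mathcal D\}$ is pseudo-invariant over $A$. -/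

import Mathlib

universe u v w

namespace PseudoInv

open scoped FirstOrder

/-- The only symbol of the language of an `n`-ary predicate. -/
inductive PredSymbol (n : ℕ) : ℕ → Type
  | mem : PredSymbol n n

/-- The language with a single relation symbol, of arity `n`. -/
def predLang (n : ℕ) : FirstOrder.Language.{0, 0} := ⟨fun _ => Empty, PredSymbol n⟩

/-- The interpretation of the predicate as the set `D`. -/
@[reducible] def predStructure {U : Type w} {n : ℕ} (D : Set (Fin n → U)) : (predLang n).Structure U where
  funMap := fun f => Empty.elim f
  RelMap := fun r => match r with
    | .mem => fun x => x ∈ D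

variable (L : FirstOrder.Language.{u, v}) {U : Type w} [L.Structure U]

/-- `L` together with an `n`-ary predicate. -/
abbrev expLang (n : ℕ) : FirstOrder.Language.{u, v} := L.sum (predLang n)

/-- The expansion `⟨U, D⟩` of `U`. -/
@[reducible] def expansion {n : ℕ} (D : Set (Fin n → U)) : (expLang L n).Structure U :=
  letI := predStructure D
  inferInstance

theorem expansion_relMap_mem {n : ℕ} (D : Set (Fin n → U)) (x : Fin n → U) :
    (expansion L D).RelMap (Sum.inr PredSymbol.mem : (expLang L n).Relations n) x ↔ x ∈ D :=
  Iff.rfl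

/-- `e(D)`: the sets `C` such that `⟨U, C⟩` and `⟨U, D⟩` are elementarily equivalent. -/
def eqClass {n : ℕ} (D : Set (Fin n → U)) : Set (Set (Fin n → U)) :=
  {C | @FirstOrder.Language.ElementarilyEquivalent (expLang L n) U U (expansion L C) (expansion L D)}

/-- `S` is defined by a formula of `L(A; D)`, that is, of the language of `⟨U, D⟩` with parameters
from `A`. -/
def DefinableWith {n m : ℕ} (A : Set U) (D : Set (Fin n → U)) (S : Set (Fin m → U)) : Prop :=
  @Set.Definable U A (expLang L n) (expansion L D) (Fin m) S

/-- `Aut(U/A)`. -/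
def autOver (A : Set U) : Set (U ≃[L] U) := {f | ∀ a ∈ A, f a = a}

/-- `o(b/A)`, the orbit of a finite tuple. -/
def orbit {n : ℕ} (A : Set U) (b : Fin n → U) : Set (Fin n → U) :=
  {c | ∃ f ∈ autOver L A, c = fun i => f (b i)}

/-- `o(D/A)`, the orbit of a set of `n`-tuples. -/
def setOrbit {n : ℕ} (A : Set U) (D : Set (Fin n → U)) : Set (Set (Fin n → U)) :=
  {C | ∃ f ∈ autOver L A, C = (fun x : Fin n → U => fun i => f (x i)) '' D}

/-- `D` is invariant over `A`. -/
def InvariantOver {n : ℕ} (A : Set U) (D : Set (Fin n → U)) : Prop :=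
  setOrbit L A D = {D}

/-- `D` is Lascar invariant over `A`: it is invariant over every (small) model containing `A`. -/
def LascarInvariantOver {n : ℕ} (A : Set U) (D : Set (Fin n → U)) : Prop :=
  ∀ M : L.ElementarySubstructure U, Cardinal.mk M < Cardinal.mk U → A ⊆ (M : Set U) →
    InvariantOver L (M : Set U) D

/-- `U` is saturated: every set of formulas in finitely many variables, with parameters from a set
of cardinality less than that of `U`, which is finitely satisfiable in `U` is realized in `U`. -/
def IsSaturated (U : Type w) [L.Structure U] : Prop :=
  ∀ A : Set U, Cardinal.mk A < Cardinal.mk U →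
    ∀ (m : ℕ) (p : Set (L[[A]].Formula (Fin m))),
      (∀ q : Finset (L[[A]].Formula (Fin m)), (q : Set (L[[A]].Formula (Fin m))) ⊆ p →
        ∃ x : Fin m → U, ∀ φ ∈ q, φ.Realize x) →
      ∃ x : Fin m → U, ∀ φ ∈ p, φ.Realize x

/-- `u` locally covers `B`. -/
def LocallyCovers {n : ℕ} (u : Set (Set (Fin n → U))) (B : Set (Fin n → U)) : Prop :=
  ∀ K ⊆ B, Cardinal.mk K = Cardinal.mk U → ∀ k : ℕ, ∃ C ∈ u,
    (k : Cardinal) ≤ Cardinal.mk (K ∩ C : Set (Fin n → U))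

/-- `D` is pseudo-invariant over `A`. -/
def PseudoInvariantOver {n : ℕ} (A : Set U) (D : Set (Fin n → U)) : Prop :=
  ∀ b ∈ D, LocallyCovers (eqClass L D) (orbit L A b)

/-- `D × ¬D`, as a set of `(n + n)`-tuples. -/
def prodCompl {n : ℕ} (D : Set (Fin n → U)) : Set (Fin (n + n) → U) :=
  {x | (fun i => x (Fin.castAdd n i)) ∈ D ∧ (fun i => x (Fin.natAdd n i)) ∉ D}

/-- `u` shatters `B`: every subset of `B` is the trace over `B` of a member of `u`. -/
def Shatters {X : Type w} (u : Set (Set X)) (B : Set X) : Prop :=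
  ∀ H ⊆ B, ∃ C ∈ u, C ∩ B = H

/-- The VC-dimension of `u` is finite. -/
def FiniteVCDim {X : Type w} (u : Set (Set X)) : Prop :=
  ∃ N : ℕ, ∀ B : Finset X, B.card = N → ¬ Shatters u (B : Set X)

/-- `κ` is a Ramsey cardinal: it is uncountable and for every colouring with two colours of the
finite subsets of a set of cardinality `κ` there is a subset `H` of cardinality `κ` such that, for
each `k`, all `k`-element subsets of `H` have the same colour. -/
def IsRamsey (κ : Cardinal.{w}) : Prop :=
  Cardinal.aleph0 < κ ∧ ∀ X : Type w, Cardinal.mk X = κ → ∀ c : Finset X → Bool,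
    ∃ H : Set X, Cardinal.mk H = κ ∧
      ∀ s t : Finset X, (s : Set X) ⊆ H → (t : Set X) ⊆ H → s.card = t.card → c s = c t

end PseudoInv

/-! Write κ for the cardinality of `U`. Small partial elementary maps of a saturated structure
extend to automorphisms (`IsElem.exists_equiv`), so equality of types over a small model M is
conjugacy under Aut(U/M).

From 1 to 2: let b ∈ S and let K ⊆ o(b/A) have cardinality κ. As κ is a strong limit, there are
fewer than κ types over a small model M ⊇ A, so infinitely many points of K share one type over M
(`exists_infinite_sameType`). Let f b be one of them, with f ∈ Aut(U/A). Then f[S] ∈ e(S) contains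
them all, because D, and with it S, is invariant over f⁻¹[M]. From 2 to 3: D × ¬D is definable.

From 3 to 1: if D is not invariant over M, there are a ∈ D and b ∉ D of the same type over M. A
Morley sequence (cᵢ), i < κ, of a type finitely satisfiable in M continues both a and b
(`exists_isMorley`). If c₀ ∈ D, the pair (c₀, b) lies in D × ¬D and is conjugate over A to every
(cᵢ₊₁, cᵢ); otherwise (a, c₀) does, conjugate to every (cᵢ, cᵢ₊₁). Pseudo-invariance and
`exists_eqClass_of_prodCompl` give D' ∈ e(D) that separates cᵢ from cᵢ₊₁, always the same way, for N
indices i. Choosing cᵢ or cᵢ₊₁ at each of these realizes every pattern on an increasing sequence,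
and indiscernibility moves that sequence back to the cᵢ. So e(D) shatters N points
(`IsMorley.shatters`), for every N. -/

namespace PseudoInv

open FirstOrder Language Cardinal
open scoped FirstOrder

/-! ### Types, elementary relations and strong homogeneity of saturated structures. -/

section Types

variable (L : FirstOrder.Language.{u, v}) {U : Type w} [L.Structure U]

/-- The families `s` and `t` have the same type over the empty set. -/
def SameType {α : Type*} (s t : α → U) : Prop :=
  ∀ φ : L.Formula α, φ.Realize s ↔ φ.Realize t

/-- The relation `R` is elementary: its two projections enumerate families of the same type. -/
def IsElem (R : Set (U × U)) : Prop :=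
  SameType L (fun z : R => z.1.1) (fun z : R => z.1.2)

variable {L}

theorem SameType.symm {α : Type*} {s t : α → U} (h : SameType L s t) : SameType L t s :=
  fun φ => (h φ).symm

theorem SameType.comp {α β : Type*} {s t : α → U} (h : SameType L s t) (f : β → α) :
    SameType L (s ∘ f) (t ∘ f) := fun φ => by
  simpa only [Formula.realize_relabel] using h (φ.relabel f)

/-- A formula has only finitely many free variables. -/
theorem sameType_of_finset {α : Type*} {s t : α → U}
    (h : ∀ G : Finset α, SameType L (fun i : G => s i) (fun i : G => t i)) : SameType L s t := by
  classical
  intro φ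
  have key (r : α → U) := BoundedFormula.realize_restrictFreeVar' (φ := φ)
    (s := (φ.freeVarFinset : Set α)) subset_rfl (v := r) (xs := default)
  exact (key s).symm.trans ((h φ.freeVarFinset _).trans (key t))

theorem SameType.eq_iff {α : Type*} {s t : α → U} (h : SameType L s t) (i j : α) :
    s i = s j ↔ t i = t j := by
  simpa using h (Term.equal (Term.var i) (Term.var j))

theorem sameType_equiv {α : Type*} (g : U ≃[L] U) (s : α → U) : SameType L s (g ∘ s) :=
  fun φ => (StrongHomClass.realize_formula g φ).symm

theorem SameType.isElem {α : Type*} {s t : α → U} (h : SameType L s t) :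
    IsElem L (Set.range fun i => (s i, t i)) := by
  choose f hf using fun z : Set.range fun i => (s i, t i) => z.2
  have h1 : (fun z : Set.range fun i => (s i, t i) => z.1.1) = s ∘ f :=
    funext fun z => congrArg Prod.fst (hf z).symm
  have h2 : (fun z : Set.range fun i => (s i, t i) => z.1.2) = t ∘ f :=
    funext fun z => congrArg Prod.snd (hf z).symm
  rw [IsElem, h1, h2]
  exact h.comp f

theorem IsElem.sameType {α : Type*} {s t : α → U} {R : Set (U × U)} (h : IsElem L R)
    (hR : ∀ i, (s i, t i) ∈ R) : SameType L s t :=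
  h.comp fun i => ⟨_, hR i⟩

theorem IsElem.swap {R : Set (U × U)} (h : IsElem L R) : IsElem L (Prod.swap ⁻¹' R) :=
  (h.comp fun z : Prod.swap ⁻¹' R => ⟨z.1.swap, z.2⟩).symm

theorem IsElem.mono {R S : Set (U × U)} (h : IsElem L R) (hS : S ⊆ R) : IsElem L S :=
  h.sameType fun z => hS z.2

theorem isElem_of_finset {R : Set (U × U)}
    (h : ∀ G : Finset (U × U), (G : Set (U × U)) ⊆ R → ∃ S, IsElem L S ∧ (G : Set (U × U)) ⊆ S) :
    IsElem L R := by
  classical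
  refine sameType_of_finset fun G => ?_
  obtain ⟨S, hS, hG⟩ := h (G.image Subtype.val) (by
    intro z hz
    obtain ⟨y, -, rfl⟩ := Finset.mem_image.1 hz
    exact y.2)
  exact hS.sameType fun i => hG (Finset.mem_image_of_mem _ i.2)

/-- With parameters as values of variables instead of constants, the same formula can be evaluated
at two different families. -/
theorem IsSaturated.exists_realize (hSat : IsSaturated L U) {α : Type*} {s : α → U}
    (hs : #(Set.range s) < #U) {m : ℕ} {p : Set (L.Formula (α ⊕ Fin m))}
    (hp : ∀ q : Finset (L.Formula (α ⊕ Fin m)), (q : Set _) ⊆ p →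
      ∃ x : Fin m → U, ∀ φ ∈ q, φ.Realize (Sum.elim s x)) :
    ∃ x : Fin m → U, ∀ φ ∈ p, φ.Realize (Sum.elim s x) := by
  classical
  let c : L.Formula (α ⊕ Fin m) → L[[Set.range s]].Formula (Fin m) := fun φ =>
    BoundedFormula.constantsVarsEquiv.symm (φ.relabel (Sum.map (Set.rangeFactorization s) id))
  have hc (φ) (x : Fin m → U) : (c φ).Realize x ↔ φ.Realize (Sum.elim s x) := by
    rw [Formula.Realize, ← BoundedFormula.realize_constantsVarsEquiv, Equiv.apply_symm_apply]
    refine Formula.realize_relabel.trans (iff_of_eq (congrArg _ ?_))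
    funext i
    rcases i with i | i <;> rfl
  obtain ⟨x, hx⟩ := hSat (Set.range s) hs m (c '' p) (by
    intro q hq
    obtain ⟨q', hq', rfl⟩ := Finset.subset_set_image_iff.1 hq
    obtain ⟨x, hx⟩ := hp q' hq'
    refine ⟨x, fun φ hφ => ?_⟩
    obtain ⟨ψ, hψ, rfl⟩ := Finset.mem_image.1 hφ
    exact (hc ψ x).2 (hx ψ hψ))
  exact ⟨x, fun φ hφ => (hc φ x).1 (hx _ ⟨φ, hφ, rfl⟩)⟩

theorem IsElem.exists_insert (hSat : IsSaturated L U) {R : Set (U × U)} (h : IsElem L R)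
    (hR : #R < #U) (a : U) : ∃ b, IsElem L (insert (a, b) R) := by
  classical
  obtain ⟨x, hx⟩ := hSat.exists_realize (s := fun z : R => z.1.2) (mk_range_le.trans_lt hR)
    (p := {φ : L.Formula (R ⊕ Fin 1) | φ.Realize (Sum.elim (fun z : R => z.1.1) fun _ => a)}) (by
      intro q hq
      have := (h (Formula.iExs (Fin 1) (BoundedFormula.iInf fun φ : q => φ.1))).1
        (Formula.realize_iExs.2 ⟨fun _ => a, BoundedFormula.realize_iInf.2 fun φ => hq φ.2⟩)
      obtain ⟨x, hx⟩ := Formula.realize_iExs.1 this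
      exact ⟨x, fun φ hφ => BoundedFormula.realize_iInf.1 hx ⟨φ, hφ⟩⟩)
  have hst : SameType L (Sum.elim (fun z : R => z.1.1) fun _ : Fin 1 => a)
      (Sum.elim (fun z : R => z.1.2) x) := fun φ =>
    ⟨hx φ, fun hφ => by_contra fun hn => hx φ.not hn hφ⟩
  refine ⟨x 0, hst.isElem.mono ?_⟩
  rintro z (rfl | hz)
  · exact ⟨Sum.inr 0, rfl⟩
  · exact ⟨Sum.inl ⟨z, hz⟩, rfl⟩

theorem IsElem.exists_insert_insert (hSat : IsSaturated L U) (hU : ℵ₀ ≤ #U) {R : Set (U × U)}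
    (h : IsElem L R) (hR : #R < #U) (a : U) :
    ∃ p : U × U, IsElem L (insert (a, p.1) (insert (p.2, a) R)) := by
  obtain ⟨b, hb⟩ := h.swap.exists_insert hSat
    (((mk_preimage_equiv (Equiv.prodComm U U) R).trans_lt hR)) a
  have hb' : IsElem L (insert (b, a) R) := by
    refine hb.swap.mono ?_
    rintro z (rfl | hz)
    · exact Or.inl rfl
    · exact Or.inr (by simpa using hz)
  obtain ⟨c, hc⟩ := hb'.exists_insert hSat
    ((mk_insert_le).trans_lt (add_lt_of_lt hU hR (one_lt_aleph0.trans_le hU))) a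
  exact ⟨(c, b), hc⟩

/-- Equality formulas make `R` the graph of a bijection; the formulas F(x) = y and r(x) make it an
isomorphism. -/
theorem IsElem.exists_equiv_of_bijective {R : Set (U × U)} (h : IsElem L R)
    (hl : ∀ a, ∃ b, (a, b) ∈ R) (hr : ∀ b, ∃ a, (a, b) ∈ R) :
    ∃ g : U ≃[L] U, ∀ z ∈ R, g z.1 = z.2 := by
  choose f hf using hl
  have huniq {z y : U × U} (hz : z ∈ R) (hy : y ∈ R) : z.1 = y.1 ↔ z.2 = y.2 :=
    SameType.eq_iff h ⟨z, hz⟩ ⟨y, hy⟩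
  have hbij : Function.Bijective f := by
    refine ⟨fun a b hab => (huniq (hf a) (hf b)).2 hab, fun b => ?_⟩
    obtain ⟨a, ha⟩ := hr b
    exact ⟨a, (huniq (hf a) ha).1 rfl⟩
  refine ⟨⟨Equiv.ofBijective f hbij, fun {n} φ x => ?_, fun {n} r x => ?_⟩,
    fun z hz => (huniq (hf z.1) hz).1 rfl⟩
  · have := (h.sameType (s := Sum.elim x fun _ : Unit => Structure.funMap φ x)
      (t := Sum.elim (f ∘ x) fun _ : Unit => f (Structure.funMap φ x))
      (by rintro (i | i) <;> exact hf _))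
      (Term.equal (Term.var (Sum.inr ())) (Term.func φ fun i => Term.var (Sum.inl i)))
    simpa [Function.comp_def] using this
  · have := (h.sameType (s := x) (t := f ∘ x) fun i => hf _) (r.formula fun i => Term.var i)
    simpa [Formula.realize_rel, Function.comp_def] using this.symm

theorem mk_Iio_ord_lt {κ : Cardinal.{w}} (i : κ.ord.ToType) : #(Set.Iio i) < κ := by
  simpa using mk_Iio_lt i (by simp)

/-- Back-and-forth along an enumeration `e` of `U` in order type κ: stage i gives `e i` both an
image and a preimage. -/
theorem IsElem.exists_equiv (hSat : IsSaturated L U) (hU : ℵ₀ < #U) {R : Set (U × U)}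
    (h : IsElem L R) (hR : #R < #U) : ∃ g : U ≃[L] U, ∀ z ∈ R, g z.1 = z.2 := by
  classical
  let I := (#U).ord.ToType
  have : Nonempty U := mk_ne_zero_iff.1 (aleph0_pos.trans hU).ne'
  obtain ⟨e⟩ : Nonempty (I ≃ U) := Cardinal.eq.1 (mk_ord_toType _)
  let S (i : I) (F : (j : I) → j < i → U × U) : Set (U × U) :=
    R ∪ ⋃ j : Set.Iio i, {(e j.1, (F j.1 j.2).1), ((F j.1 j.2).2, e j.1)}
  let P (i : I) (F : (j : I) → j < i → U × U) (p : U × U) : Prop :=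
    IsElem L (insert (e i, p.1) (insert (p.2, e i) (S i F)))
  -- `epsilon` yields some pair even where no extension exists; `hF` recovers the property once
  -- existence is known.
  let F : I → U × U := WellFoundedLT.fix fun i F => Classical.epsilon (P i F)
  let T (i : I) : Set (U × U) := R ∪ ⋃ j : Set.Iio i, {(e j, (F j).1), ((F j).2, e j)}
  let T' (i : I) : Set (U × U) := insert (e i, (F i).1) (insert ((F i).2, e i) (T i))
  have hF (i : I) (hi : ∃ p : U × U, IsElem L (insert (e i, p.1) (insert (p.2, e i) (T i)))) :
      IsElem L (T' i) := by
    have : F i = Classical.epsilon (P i fun j _ => F j) := WellFoundedLT.fix_eq _ _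
    have h2 := Classical.epsilon_spec (p := P i fun j _ => F j) hi
    rw [← this] at h2
    exact h2
  have hTT {i j : I} (hij : i < j) : T' i ⊆ T j := by
    rintro z (rfl | rfl | hz | hz)
    · exact Or.inr (Set.mem_iUnion.2 ⟨⟨i, hij⟩, Or.inl rfl⟩)
    · exact Or.inr (Set.mem_iUnion.2 ⟨⟨i, hij⟩, Or.inr rfl⟩)
    · exact Or.inl hz
    · obtain ⟨k, hk⟩ := Set.mem_iUnion.1 hz
      exact Or.inr (Set.mem_iUnion.2 ⟨⟨k, k.2.trans hij⟩, hk⟩)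
  have hTT' {i j : I} (hij : i ≤ j) : T' i ⊆ T' j := by
    rcases hij.eq_or_lt with rfl | hij
    · exact subset_rfl
    · exact (hTT hij).trans ((Set.subset_insert _ _).trans (Set.subset_insert _ _))
  -- The stages form a chain, so a finite part of the union lies in `R` or in a single stage.
  have hfin (J : Set I) (hJ : ∀ i ∈ J, IsElem L (T' i)) : IsElem L (R ∪ ⋃ i ∈ J, T' i) := by
    refine isElem_of_finset fun G => ?_
    have : ∀ G : Finset (U × U), (G : Set (U × U)) ⊆ (R ∪ ⋃ i ∈ J, T' i) →
        (G : Set (U × U)) ⊆ R ∨ ∃ i ∈ J, (G : Set (U × U)) ⊆ T' i := by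
      intro G
      induction G using Finset.induction_on with
      | empty => exact fun _ => Or.inl (by simp)
      | insert z G _ ih =>
        intro hG
        rw [Finset.coe_insert, Set.insert_subset_iff] at hG
        have hz : z ∈ R ∨ ∃ i ∈ J, z ∈ T' i := by simpa using hG.1
        have hRT (i : I) : R ⊆ T' i := fun y hy => Or.inr (Or.inr (Or.inl hy))
        rcases ih hG.2 with h1 | ⟨i, hi, h1⟩ <;> rcases hz with hz | ⟨j, hj, hz⟩
        · left; simpa [Set.insert_subset_iff] using ⟨hz, h1⟩
        · refine Or.inr ⟨j, hj, ?_⟩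
          simpa [Set.insert_subset_iff] using ⟨hz, h1.trans (hRT j)⟩
        · refine Or.inr ⟨i, hi, ?_⟩
          simpa [Set.insert_subset_iff] using ⟨hRT i hz, h1⟩
        · rcases le_total i j with hij | hij
          · refine Or.inr ⟨j, hj, ?_⟩
            simpa [Set.insert_subset_iff] using ⟨hz, h1.trans (hTT' hij)⟩
          · refine Or.inr ⟨i, hi, ?_⟩
            simpa [Set.insert_subset_iff] using ⟨hTT' hij hz, h1⟩
    exact fun hG => (this G hG).elim (fun h1 => ⟨R, h, h1⟩) fun ⟨i, hi, h1⟩ => ⟨_, hJ i hi, h1⟩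
  have hcard (i : I) : #(T i) < #U := by
    refine (mk_union_le _ _).trans_lt (add_lt_of_lt hU.le hR ?_)
    refine (mk_iUnion_le_sum_mk.trans (sum_le_mk_mul_iSup _)).trans_lt ?_
    refine (mul_le_mul_right (ciSup_le' fun j => (?_ : _ ≤ ℵ₀)) _).trans_lt
      (mul_lt_of_lt hU.le (mk_Iio_ord_lt i) hU)
    exact ((Set.finite_singleton _).insert _).lt_aleph0.le
  have hall (i : I) : IsElem L (T' i) := by
    induction i using WellFoundedLT.induction with
    | ind i ih =>
    refine hF i (IsElem.exists_insert_insert hSat hU.le ?_ (hcard i) (e i))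
    refine (hfin (Set.Iio i) ih).mono (Set.union_subset_union_right _ ?_)
    refine Set.iUnion_subset fun j z hz => Set.mem_biUnion j.2 ?_
    rcases hz with rfl | rfl
    · exact Or.inl rfl
    · exact Or.inr (Or.inl rfl)
  obtain ⟨g, hg⟩ := (hfin Set.univ fun i _ => hall i).exists_equiv_of_bijective
    (e.surjective.forall.2 fun i => ⟨_, Or.inr (Set.mem_biUnion (Set.mem_univ i) (Or.inl rfl))⟩)
    (e.surjective.forall.2 fun i =>
      ⟨_, Or.inr (Set.mem_biUnion (Set.mem_univ i) (Or.inr (Or.inl rfl)))⟩)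
  exact ⟨g, fun z hz => hg z (Or.inl hz)⟩

theorem SameType.exists_equiv (hSat : IsSaturated L U) (hU : ℵ₀ < #U) {α : Type w} {s t : α → U}
    (h : SameType L s t) (hα : #α < #U) : ∃ g : U ≃[L] U, ∀ i, g (s i) = t i := by
  obtain ⟨g, hg⟩ := h.isElem.exists_equiv hSat hU (mk_range_le.trans_lt hα)
  exact ⟨g, fun i => hg _ ⟨i, rfl⟩⟩

end Types

/-! ### Average types of ultrafilters on a model, and Morley sequences. -/

section Average

variable {L : FirstOrder.Language.{u, v}} {U : Type w} [L.Structure U]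

/-- The tuple `c` realizes over `s` the average type of the ultrafilter `F` of tuples of `M`. -/
def IsAvg {M : L.ElementarySubstructure U} {n : ℕ} (F : Ultrafilter (Fin n → M)) {α : Type*}
    (s : α → U) (c : Fin n → U) : Prop :=
  ∀ φ : L.Formula (α ⊕ Fin n),
    φ.Realize (Sum.elim s c) ↔
      ∀ᶠ x in (F : Filter (Fin n → M)), φ.Realize (Sum.elim s fun i => (x i : U))

/-- The sequence `c` is a Morley sequence over `M` of the average type of `F`. -/
def IsMorley {M : L.ElementarySubstructure U} {n : ℕ} (F : Ultrafilter (Fin n → M)) {I : Type*}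
    [Preorder I] (c : I → Fin n → U) : Prop :=
  ∀ i, IsAvg F (Sum.elim (fun a : M => (a : U)) fun p : Set.Iio i × Fin n => c p.1 p.2) (c i)

variable {M : L.ElementarySubstructure U} {n : ℕ} {F : Ultrafilter (Fin n → M)}

theorem IsAvg.comp {α β : Type*} {s : α → U} {c : Fin n → U} (h : IsAvg F s c) (f : β → α)
    {t : β → U} (ht : ∀ i, t i = s (f i)) : IsAvg F t c := fun φ => by
  obtain rfl : t = s ∘ f := funext ht
  have key (x : Fin n → U) : (φ.relabel (Sum.map f id)).Realize (Sum.elim s x) ↔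
      φ.Realize (Sum.elim (s ∘ f) x) := by
    rw [Formula.realize_relabel, Sum.elim_comp_map, Function.comp_id]
  simpa only [key] using h (φ.relabel (Sum.map f id))

theorem IsAvg.of_sameType {α : Type*} {s : α → U} {c d : Fin n → U} (h : IsAvg F s c)
    (hd : SameType L (Sum.elim s c) (Sum.elim s d)) : IsAvg F s d :=
  fun φ => (hd φ).symm.trans (h φ)

theorem exists_isAvg (hSat : IsSaturated L U) {α : Type*} {s : α → U}
    (hs : #(Set.range s) < #U) : ∃ c, IsAvg F s c := by
  obtain ⟨c, hc⟩ := hSat.exists_realize hs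
    (p := {φ : L.Formula (α ⊕ Fin n) | ∀ᶠ x in (F : Filter (Fin n → M)),
      φ.Realize (Sum.elim s fun i => (x i : U))})
    (fun q hq => by
      obtain ⟨x, hx⟩ := ((Finset.eventually_all q).2 hq).exists
      exact ⟨_, hx⟩)
  refine ⟨c, fun φ => ⟨fun hφ => ?_, hc φ⟩⟩
  by_contra hn
  exact hc φ.not (Ultrafilter.eventually_not.2 hn) hφ

theorem ElementarySubstructure.exists_realize {α : Type*} (s : α → M)
    (φ : L.Formula (α ⊕ Fin n)) {a : Fin n → U}
    (h : φ.Realize (Sum.elim (fun i => (s i : U)) a)) :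
    ∃ x : Fin n → M, φ.Realize (Sum.elim (fun i => (s i : U)) fun i => (x i : U)) := by
  have h1 : (Formula.iExs (Fin n) φ).Realize (M.subtype ∘ s) := Formula.realize_iExs.2 ⟨a, h⟩
  rw [ElementaryEmbedding.map_formula, Formula.realize_iExs] at h1
  obtain ⟨x, hx⟩ := h1
  refine ⟨x, ?_⟩
  rw [← ElementaryEmbedding.map_formula M.subtype, Sum.comp_elim] at hx
  exact hx

-- Elementarity of `M` makes the type of `a` over `M` finitely satisfiable in `M`, so its traces on
-- tuples of `M` have the finite intersection property.
variable (M) in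
theorem exists_ultrafilter_isAvg (a : Fin n → U) :
    ∃ F : Ultrafilter (Fin n → M), IsAvg F (fun m : M => (m : U)) a := by
  let S (φ : L.Formula (M ⊕ Fin n)) : Set (Fin n → M) :=
    {x | φ.Realize (Sum.elim (fun m : M => (m : U)) fun i => (x i : U))}
  obtain ⟨F, hF⟩ := Ultrafilter.exists_ultrafilter_of_finite_inter_nonempty
    (S '' {φ | φ.Realize (Sum.elim (fun m : M => (m : U)) a)}) (by
      classical
      intro T hT
      obtain ⟨q, hq, rfl⟩ := Finset.subset_set_image_iff.1 hT
      obtain ⟨x, hx⟩ := ElementarySubstructure.exists_realize id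
        (BoundedFormula.iInf fun φ : q => φ.1) (BoundedFormula.realize_iInf.2 fun φ => hq φ.2)
      refine ⟨x, ?_⟩
      rintro _ hy
      obtain ⟨φ, hφ, rfl⟩ := Finset.mem_image.1 hy
      exact BoundedFormula.realize_iInf.1 hx ⟨φ, hφ⟩)
  refine ⟨F, fun φ => ⟨fun hφ => hF ⟨φ, hφ, rfl⟩, fun h => ?_⟩⟩
  by_contra hn
  have h2 : ∀ᶠ x in (F : Filter (Fin n → M)),
      φ.not.Realize (Sum.elim (fun m : M => (m : U)) fun i => (x i : U)) :=
    hF ⟨φ.not, hn, rfl⟩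
  obtain ⟨x, hx, hx'⟩ := (h.and h2).exists
  exact hx' hx

theorem IsMorley.comp {I J : Type*} [Preorder I] [Preorder J] {c : I → Fin n → U}
    (h : IsMorley F c) {f : J → I} (hf : StrictMono f) : IsMorley F (c ∘ f) := fun i =>
  (h (f i)).comp (Sum.map id fun p : Set.Iio i × Fin n =>
    ((⟨f p.1, hf p.1.2⟩ : Set.Iio (f i)), p.2)) (by rintro (x | x) <;> rfl)

/-- Indiscernibility: the average type does not split over `M`, so the type of a Morley sequence is
determined one term at a time. -/
theorem IsMorley.sameType {k : ℕ} {c d : Fin k → Fin n → U} (hc : IsMorley F c)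
    (hd : IsMorley F d) :
    SameType L (Sum.elim (fun a : M => (a : U)) fun p : Fin k × Fin n => c p.1 p.2)
      (Sum.elim (fun a : M => (a : U)) fun p : Fin k × Fin n => d p.1 p.2) := by
  induction k with
  | zero =>
    obtain rfl : c = d := funext fun i => i.elim0
    exact fun _ => Iff.rfl
  | succ k ih =>
    have hlast {c : Fin (k + 1) → Fin n → U} (hc : IsMorley F c) :
        IsAvg F (Sum.elim (fun a : M => (a : U)) fun p : Fin k × Fin n => c p.1.castSucc p.2)
          (c (Fin.last k)) := by
      exact (hc (Fin.last k)).comp (Sum.map id fun p : Fin k × Fin n =>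
        ((⟨p.1.castSucc, p.1.castSucc_lt_last⟩ : Set.Iio (Fin.last k)), p.2))
        (by rintro (x | x) <;> rfl)
    have hst := ih (hc.comp Fin.strictMono_castSucc) (hd.comp Fin.strictMono_castSucc)
    have key : SameType L
        (Sum.elim (Sum.elim (fun a : M => (a : U)) fun p : Fin k × Fin n => c p.1.castSucc p.2)
          (c (Fin.last k)))
        (Sum.elim (Sum.elim (fun a : M => (a : U)) fun p : Fin k × Fin n => d p.1.castSucc p.2)
          (d (Fin.last k))) := by
      intro φ
      rw [hlast hc φ, hlast hd φ]
      refine Filter.eventually_congr (Filter.Eventually.of_forall fun x => ?_)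
      -- The tuple `x` lies in `M`, so it can be read off the parameters already covered by `hst`.
      convert hst.comp (Sum.elim id (Sum.inl ∘ x)) φ using 2 <;>
      · funext z
        rcases z with z | z <;> rfl
    convert key.comp (Sum.elim (Sum.inl ∘ Sum.inl) fun p : Fin (k + 1) × Fin n =>
      Fin.lastCases (motive := fun _ => (M ⊕ Fin k × Fin n) ⊕ Fin n) (Sum.inr p.2)
        (fun j => Sum.inl (Sum.inr (j, p.2))) p.1) using 1 <;>
    · funext z
      rcases z with z | ⟨i, j⟩
      · rfl
      · induction i using Fin.lastCases <;> simp

/-- Two tuples with the same type over a small model `M` can both be followed by the same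
`M`-indiscernible sequence, of length the cardinality of `U`. -/
theorem exists_isMorley (hSat : IsSaturated L U) (hU : ℵ₀ < #U) (hM : #M < #U)
    {a b : Fin n → U} (hab : SameType L (Sum.elim (fun m : M => (m : U)) a)
      (Sum.elim (fun m : M => (m : U)) b)) :
    ∃ (F : Ultrafilter (Fin n → M)) (c : (#U).ord.ToType → Fin n → U), IsMorley F c ∧
      ∀ i, IsMorley F ![a, c i] ∧ IsMorley F ![b, c i] := by
  obtain ⟨F, ha⟩ := exists_ultrafilter_isAvg M a
  have hb := ha.of_sameType hab
  -- Both `a` and `b` are among the parameters, so that one sequence continues each of them.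
  let s (i : (#U).ord.ToType) (c : (j : (#U).ord.ToType) → j < i → Fin n → U) :
      (M ⊕ (Fin n ⊕ Fin n)) ⊕ Set.Iio i × Fin n → U :=
    Sum.elim (Sum.elim (fun m : M => (m : U)) (Sum.elim a b)) fun p => c p.1.1 p.1.2 p.2
  have hs (i c) : ∃ d, IsAvg F (s i c) d := by
    refine exists_isAvg hSat (mk_range_le.trans_lt ?_)
    have hfin : #(Fin n) < ℵ₀ := lt_aleph0_of_finite _
    have hfin' : lift.{w} #(Fin n) < #U := (lift_lt_aleph0.2 hfin).trans hU
    simp only [mk_sum, mk_prod, lift_id, lift_uzero, lift_add]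
    exact add_lt_of_lt hU.le (add_lt_of_lt hU.le hM (add_lt_of_lt hU.le hfin' hfin'))
      (mul_lt_of_lt hU.le (mk_Iio_ord_lt i) hfin')
  let c : (#U).ord.ToType → Fin n → U :=
    WellFoundedLT.fix fun i c => Classical.choose (hs i c)
  have hc (i) : IsAvg F (s i fun j _ => c j) (c i) := by
    have : c i = Classical.choose (hs i fun j _ => c j) := WellFoundedLT.fix_eq _ _
    rw [this]
    exact Classical.choose_spec (hs i fun j _ => c j)
  refine ⟨F, c, fun i => ?_, fun i => ⟨Fin.forall_fin_two.2 ⟨?_, ?_⟩, Fin.forall_fin_two.2 ⟨?_, ?_⟩⟩⟩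
  · exact (hc i).comp (Sum.map Sum.inl id) (by rintro (x | x) <;> rfl)
  · exact ha.comp (Sum.elim id fun p : Set.Iio (0 : Fin 2) × Fin n =>
      ((Fin.not_lt_zero _ p.1.2).elim : M))
      (by rintro (x | p); exacts [rfl, (Fin.not_lt_zero _ p.1.2).elim])
  · refine (hc i).comp (Sum.elim (Sum.inl ∘ Sum.inl) fun p : Set.Iio (1 : Fin 2) × Fin n =>
      Sum.inl (Sum.inr (Sum.inl p.2))) ?_
    rintro (x | ⟨⟨j, hj⟩, p⟩)
    · rfl
    · obtain rfl : j = 0 := by simpa using hj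
      rfl
  · exact hb.comp (Sum.elim id fun p : Set.Iio (0 : Fin 2) × Fin n =>
      ((Fin.not_lt_zero _ p.1.2).elim : M))
      (by rintro (x | p); exacts [rfl, (Fin.not_lt_zero _ p.1.2).elim])
  · refine (hc i).comp (Sum.elim (Sum.inl ∘ Sum.inl) fun p : Set.Iio (1 : Fin 2) × Fin n =>
      Sum.inl (Sum.inr (Sum.inr p.2))) ?_
    rintro (x | ⟨⟨j, hj⟩, p⟩)
    · rfl
    · obtain rfl : j = 0 := by simpa using hj
      rfl

end Average

/-! ### Expansions by a predicate and their automorphisms. -/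

section Expansion

variable {L : FirstOrder.Language.{u, v}} {U : Type w} [L.Structure U]

/-- An automorphism of `U` mapping `D` onto `C` is an isomorphism of the expansions. -/
def expansionEquiv {n : ℕ} (g : U ≃[L] U) {D C : Set (Fin n → U)}
    (h : ∀ x, g ∘ x ∈ C ↔ x ∈ D) :
    @Language.Equiv (expLang L n) U U (expansion L D) (expansion L C) :=
  @Language.Equiv.mk (expLang L n) U U (expansion L D) (expansion L C) g.toEquiv
    (fun {k} f x => by
      rcases f with f | f
      · exact g.map_fun f x
      · exact Empty.elim f)
    (fun {k} r x => by
      rcases r with r | r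
      · exact g.map_rel r x
      · cases r
        exact h x)

theorem mem_eqClass_of_equiv {n : ℕ} (g : U ≃[L] U) {D C : Set (Fin n → U)}
    (h : ∀ x, g ∘ x ∈ C ↔ x ∈ D) : C ∈ eqClass L D :=
  Eq.symm (@StrongHomClass.elementarilyEquivalent (expLang L n) U U (expansion L D)
    (expansion L C) _ _ (@Equiv.instStrongHomClass (expLang L n) U U (expansion L D)
    (expansion L C)) (expansionEquiv g h))

theorem DefinableWith.mem_iff {n m : ℕ} {A : Set U} {D : Set (Fin n → U)} {S : Set (Fin m → U)}
    (hS : DefinableWith L A D S) {g : U ≃[L] U} (hg : g ∈ autOver L A)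
    (h : ∀ x, g ∘ x ∈ D ↔ x ∈ D) (x : Fin m → U) : g ∘ x ∈ S ↔ x ∈ S := by
  let _ := expansion L D
  obtain ⟨φ, rfl⟩ := Set.definable_iff_exists_formula_sum.1 hS
  have := StrongHomClass.realize_formula (L := expLang L n) (expansionEquiv g h) φ
    (v := Sum.elim (fun a : A => (a : U)) x)
  have h1 : expansionEquiv g h ∘ Sum.elim (fun a : A => (a : U)) x =
      Sum.elim (fun a : A => (a : U)) (g ∘ x) := by
    funext i
    rcases i with i | i
    · exact hg i i.2
    · rfl
  exact (h1 ▸ this :)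

/-! ### Interpreting one expansion in another. -/

section Interpretation

variable {m n : ℕ}

/-- A term of `L` with an `n`-ary predicate is a term of `L` with an `m`-ary predicate. -/
def interpTerm {α : Type*} : (expLang L n).Term α → (expLang L m).Term α
  | .var i => .var i
  | .func (Sum.inl f) ts => .func (Sum.inl f) fun i => interpTerm (ts i)
  | .func (Sum.inr f) _ => Empty.elim f

/-- Replace the `n`-ary predicate by the formula `θ` in the `m`-ary predicate. -/
def interp (θ : (expLang L m).Formula (Fin n)) {α : Type*} :
    {k : ℕ} → (expLang L n).BoundedFormula α k → (expLang L m).BoundedFormula α k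
  | _, .falsum => .falsum
  | _, .equal s t => .equal (interpTerm s) (interpTerm t)
  | _, .rel (Sum.inl r) ts => .rel (Sum.inl r) fun i => interpTerm (ts i)
  | _, .rel (Sum.inr .mem) ts =>
    -- Substitution leaves free variables in `α ⊕ Fin k`; relabelling by `id` makes the `Fin k` part
    -- bound indices again.
    BoundedFormula.relabel id (BoundedFormula.subst θ fun i => interpTerm (ts i))
  | _, .imp φ ψ => .imp (interp θ φ) (interp θ ψ)
  | _, .all φ => .all (interp θ φ)

theorem realize_interpTerm {α : Type*} {D : Set (Fin n → U)} {E : Set (Fin m → U)}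
    (t : (expLang L n).Term α) (s : α → U) :
    @Term.realize (expLang L m) U (expansion L E) α s (interpTerm t) =
      @Term.realize (expLang L n) U (expansion L D) α s t := by
  induction t with
  | var i => rfl
  | func f ts ih =>
    rcases f with f | f
    · exact congrArg (Structure.funMap f) (funext ih)
    · exact Empty.elim f

theorem realize_interp {θ : (expLang L m).Formula (Fin n)} {D : Set (Fin n → U)}
    {E : Set (Fin m → U)}
    (hθ : ∀ x, @Formula.Realize (expLang L m) U (expansion L E) _ θ x ↔ x ∈ D)
    {α : Type*} {k : ℕ} (φ : (expLang L n).BoundedFormula α k) (s : α → U) (xs : Fin k → U) :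
    @BoundedFormula.Realize (expLang L m) U (expansion L E) α k (interp θ φ) s xs ↔
      @BoundedFormula.Realize (expLang L n) U (expansion L D) α k φ s xs := by
  induction φ with
  | falsum => rfl
  | equal t₁ t₂ =>
    exact iff_of_eq (congrArg₂ Eq (realize_interpTerm t₁ _) (realize_interpTerm t₂ _))
  | rel r ts =>
    rcases r with r | r
    · exact iff_of_eq (congrArg (Structure.RelMap r) (funext fun i => realize_interpTerm (ts i) _))
    · cases r
      let _ := expansion L E
      refine BoundedFormula.realize_relabel.trans (BoundedFormula.realize_subst.trans ?_)
      refine Iff.trans ?_ (hθ _)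
      refine iff_of_eq (congrArg₂ _ (funext fun i => ?_) (Subsingleton.elim _ _))
      exact realize_interpTerm (ts i) _
  | imp φ ψ ih₁ ih₂ => exact imp_congr (ih₁ xs) (ih₂ xs)
  | all φ ih => exact forall_congr' fun a => ih _

/-- Sets defined by the same formula in elementarily equivalent expansions have elementarily
equivalent expansions. -/
theorem mem_eqClass_of_formula {θ : (expLang L m).Formula (Fin n)} {D D' : Set (Fin n → U)}
    {E E' : Set (Fin m → U)}
    (hD : ∀ x, @Formula.Realize (expLang L m) U (expansion L E) _ θ x ↔ x ∈ D)
    (hD' : ∀ x, @Formula.Realize (expLang L m) U (expansion L E') _ θ x ↔ x ∈ D')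
    (hE : E' ∈ eqClass L E) : D' ∈ eqClass L D := by
  refine (@elementarilyEquivalent_iff _ _ _ (expansion L D') (expansion L D)).2 fun φ => ?_
  refine (realize_interp hD' φ _ _).symm.trans (Iff.trans ?_ (realize_interp hD φ _ _))
  exact (@elementarilyEquivalent_iff _ _ _ (expansion L E') (expansion L E)).1 hE (interp θ φ)

end Interpretation

/-! ### The set D × ¬D. -/

theorem definableWith_prodCompl {n : ℕ} (A : Set U) (D : Set (Fin n → U)) :
    DefinableWith L A D (prodCompl D) := by
  let _ := expansion L D
  have hD : A.Definable (expLang L n) D := by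
    refine Set.Definable.mono (Set.empty_definable_iff.2 ⟨Relations.formula
      (Sum.inr PredSymbol.mem : (expLang L n).Relations n) fun i => Term.var i, ?_⟩)
      (Set.empty_subset A)
    ext x
    exact Iff.symm Formula.realize_rel
  exact (hD.preimage_comp (Fin.castAdd n)).inter (hD.preimage_comp (Fin.natAdd n)).compl

theorem append_mem_prodCompl {n : ℕ} {D : Set (Fin n → U)} {x y : Fin n → U} :
    Fin.append x y ∈ prodCompl D ↔ x ∈ D ∧ y ∉ D := by
  simp only [prodCompl, Set.mem_ofPred_eq, Fin.append_left, Fin.append_right]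

/-- A set `C` with `⟨U, C⟩ ≡ ⟨U, D × ¬D⟩` is contained in `D' × ¬D'` for some `D'` with
`⟨U, D'⟩ ≡ ⟨U, D⟩`. -/
theorem exists_eqClass_of_prodCompl {n : ℕ} {D : Set (Fin n → U)} (hD : ∃ y, y ∉ D)
    {C : Set (Fin (n + n) → U)} (hC : C ∈ eqClass L (prodCompl D)) :
    ∃ D' ∈ eqClass L D, C ⊆ prodCompl D' := by
  let R : (expLang L (n + n)).Relations (n + n) := Sum.inr PredSymbol.mem
  -- The projection of the predicate to its first `n` coordinates.
  let θ : (expLang L (n + n)).Formula (Fin n) :=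
    Formula.iExs (Fin n) (R.formula (Fin.append (fun i => Term.var (Sum.inl i))
      fun i => Term.var (Sum.inr i)))
  have hθ (E : Set (Fin (n + n) → U)) (x : Fin n → U) :
      @Formula.Realize (expLang L (n + n)) U (expansion L E) _ θ x ↔
        ∃ y : Fin n → U, Fin.append x y ∈ E := by
    let _ := expansion L E
    refine Formula.realize_iExs.trans (exists_congr fun y => Formula.realize_rel.trans ?_)
    refine iff_of_eq (congrArg (· ∈ E) (funext fun i => ?_))
    refine Fin.addCases (fun i => ?_) (fun i => ?_) i
    · simp only [Fin.append_left, Term.realize_var, Sum.elim_inl]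
    · simp only [Fin.append_right, Term.realize_var, Sum.elim_inr]
  -- No second half of a tuple in the predicate belongs to the projection. This holds for D × ¬D,
  -- hence for `C`.
  let ψ : (expLang L (n + n)).Sentence :=
    Formula.iAlls (α := Empty) (Fin (n + n))
      ((R.formula fun i => Term.var (Sum.inr i)).imp
        (Formula.not (θ.relabel fun i => Sum.inr (Fin.natAdd n i))))
  have hψ (E : Set (Fin (n + n) → U)) : @Sentence.Realize (expLang L (n + n)) U (expansion L E) ψ ↔
      ∀ x ∈ E, ¬ ∃ y : Fin n → U, Fin.append (fun i => x (Fin.natAdd n i)) y ∈ E := by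
    let _ := expansion L E
    refine Formula.realize_iAlls.trans (forall_congr' fun x => ?_)
    refine Formula.realize_imp.trans (imp_congr Formula.realize_rel ?_)
    exact Formula.realize_not.trans (not_congr (Formula.realize_relabel.trans (hθ E _)))
  have hCψ := (hψ C).1 (((@elementarilyEquivalent_iff _ _ _ (expansion L C)
    (expansion L (prodCompl D))).1 hC ψ).2 ((hψ _).2 fun x hx ⟨y, hy⟩ =>
      hx.2 (append_mem_prodCompl.1 hy).1))
  refine ⟨{x | ∃ y : Fin n → U, Fin.append x y ∈ C}, mem_eqClass_of_formula (θ := θ)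
    (fun x => (hθ _ x).trans ?_) (fun x => hθ C x) hC, fun x hx =>
      ⟨⟨fun i => x (Fin.natAdd n i), ?_⟩, hCψ x hx⟩⟩
  -- A point outside `D` is needed here: otherwise D × ¬D is empty and its projection need not be
  -- `D`.
  · exact ⟨fun ⟨y, hy⟩ => (append_mem_prodCompl.1 hy).1,
      fun hx => ⟨hD.choose, append_mem_prodCompl.2 ⟨hx, hD.choose_spec⟩⟩⟩
  · rw [Fin.append_castAdd_natAdd]
    exact hx

end Expansion

/-! ### Invariance, and the implications between the three conditions. -/

section Main

variable {L : FirstOrder.Language.{u, v}} {U : Type w} [L.Structure U]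

theorem mem_image_equiv_iff (g : U ≃[L] U) {n : ℕ} {D : Set (Fin n → U)} {x : Fin n → U} :
    x ∈ (fun y : Fin n → U => fun i => g (y i)) '' D ↔ g.symm ∘ x ∈ D := by
  refine ⟨?_, fun h => ⟨_, h, funext fun i => g.apply_symm_apply (x i)⟩⟩
  rintro ⟨y, hy, rfl⟩
  convert hy using 1
  exact funext fun i => g.symm_apply_apply (y i)

theorem symm_mem_autOver {A : Set U} {g : U ≃[L] U} (hg : g ∈ autOver L A) :
    g.symm ∈ autOver L A := fun a ha => by
  conv_lhs => rw [← hg a ha]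
  exact g.symm_apply_apply a

theorem invariantOver_iff {A : Set U} {n : ℕ} {D : Set (Fin n → U)} :
    InvariantOver L A D ↔ ∀ g ∈ autOver L A, ∀ x, g ∘ x ∈ D ↔ x ∈ D := by
  constructor
  · intro h g hg x
    have hC : (fun y : Fin n → U => fun i => g.symm (y i)) '' D ∈ setOrbit L A D :=
      ⟨g.symm, symm_mem_autOver hg, rfl⟩
    have hCD := Set.mem_singleton_iff.1 (h.subset hC)
    conv_rhs => rw [← hCD]
    exact (mem_image_equiv_iff g.symm).symm
  · refine fun h => Set.eq_singleton_iff_unique_mem.2 ⟨⟨Language.Equiv.refl L U, fun a _ => rfl,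
      (Set.image_id D).symm⟩, ?_⟩
    rintro _ ⟨g, hg, rfl⟩
    ext x
    rw [mem_image_equiv_iff]
    exact h _ (symm_mem_autOver hg) x

theorem ElementarySubstructure.exists_eq_image (M : L.ElementarySubstructure U) (g : U ≃[L] U) :
    ∃ N : L.ElementarySubstructure U, (N : Set U) = g '' M := by
  let j : M ↪ₑ[L] U := g.toElementaryEmbedding.comp M.subtype
  let e := j.toEmbedding.equivRange
  refine ⟨⟨j.toEmbedding.toHom.range, fun n φ x => ?_⟩, ?_⟩
  · obtain ⟨y, rfl⟩ : ∃ y, x = e ∘ y := ⟨e.symm ∘ x, funext fun i => (e.apply_symm_apply _).symm⟩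
    rw [StrongHomClass.realize_formula e φ]
    exact j.map_formula φ y
  · ext x
    constructor
    · rintro ⟨y, rfl⟩
      exact ⟨y, y.2, rfl⟩
    · rintro ⟨y, hy, rfl⟩
      exact ⟨⟨y, hy⟩, rfl⟩

theorem exists_small_elementarySubstructure (hU : ℵ₀ < #U)
    (hL : lift.{w} L.card < lift.{max u v} #U) {A : Set U} (hA : #A < #U) :
    ∃ M : L.ElementarySubstructure U, #M < #U ∧ A ⊆ M := by
  obtain ⟨M, hAM, hM⟩ := exists_elementarySubstructure_card_eq L A
    (max ℵ₀ (max (lift.{max u v} #A) (lift.{w} L.card))) (le_max_left _ _)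
    (by simp) (by simp) (by
      simp only [lift_max, lift_aleph0, lift_lift, max_le_iff]
      refine ⟨aleph0_le_lift.2 hU.le, lift_le.2 hA.le, ?_⟩
      exact hL.le.trans_eq (congrFun lift_umax.{w, max u v} _).symm)
  refine ⟨M, lift_lt.{w, max u v w}.1 (hM.trans_lt ?_), hAM⟩
  simp only [lift_max, lift_aleph0, lift_lift, max_lt_iff]
  refine ⟨aleph0_lt_lift.2 hU, lift_lt.2 hA, ?_⟩
  exact hL.trans_eq (congrFun lift_umax.{w, max u v} _).symm

/-- There are fewer than κ formulas over `M`, hence fewer than κ types because κ is a strong limit;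
some type has an infinite fibre in `K`. -/
theorem exists_infinite_sameType (hI : IsInaccessible #U)
    (hL : lift.{w} L.card < lift.{max u v} #U) {M : L.ElementarySubstructure U} (hM : #M < #U)
    {m : ℕ} {K : Set (Fin m → U)} (hK : #K = #U) :
    ∃ T ⊆ K, T.Infinite ∧ ∀ x ∈ T, ∀ y ∈ T,
      SameType L (Sum.elim (fun a : M => (a : U)) x) (Sum.elim (fun a : M => (a : U)) y) := by
  have hU := hI.aleph0_lt
  have hform : #(L.Formula (M ⊕ Fin m)) < lift.{max u v} #U := by
    have h1 : #(L.Formula (M ⊕ Fin m)) ≤ #(Σ k, L.BoundedFormula (M ⊕ Fin m) k) :=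
      mk_le_of_injective (f := fun φ : L.Formula (M ⊕ Fin m) =>
        (⟨0, φ⟩ : Σ k, L.BoundedFormula (M ⊕ Fin m) k)) fun φ ψ h => by simpa using h
    refine (h1.trans BoundedFormula.card_le).trans_lt (max_lt (aleph0_lt_lift.2 hU) ?_)
    refine add_lt_of_lt (aleph0_le_lift.2 hU.le) (lift_lt.2 ?_) hL
    have hfin : lift.{w} #(Fin m) < #U := (lift_lt_aleph0.2 (lt_aleph0_of_finite _)).trans hU
    simpa only [mk_sum, lift_uzero] using add_lt_of_lt hU.le hM hfin
  have hset : #(Set (L.Formula (M ⊕ Fin m))) < #(ULift.{max u v} K) := by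
    rw [mk_uLift, hK, mk_set]
    obtain ⟨c, hc, hc'⟩ := lt_lift_iff.1 hform
    rw [← hc', ← lift_two_power, lift_lt]
    exact hI.isStrongPrelimit hc
  have : Infinite (ULift.{max u v} K) := by
    rw [infinite_iff, mk_uLift, hK]
    exact aleph0_le_lift.2 hU.le
  obtain ⟨p, hp⟩ := exists_infinite_fiber (fun x : ULift.{max u v} K =>
    {φ : L.Formula (M ⊕ Fin m) | φ.Realize (Sum.elim (fun a : M => (a : U)) x.down.1)}) hset
  refine ⟨(fun x : ULift.{max u v} K => x.down.1) '' _, ?_,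
    (Set.infinite_coe_iff.1 hp).image fun x _ y _ h => ULift.ext _ _ (Subtype.ext h), ?_⟩
  · rintro _ ⟨x, -, rfl⟩
    exact x.down.2
  rintro _ ⟨x, hx, rfl⟩ _ ⟨y, hy, rfl⟩ φ
  exact Set.ext_iff.1 ((Set.mem_singleton_iff.1 hx).trans (Set.mem_singleton_iff.1 hy).symm) φ

/-- Sets definable from a Lascar invariant set are pseudo-invariant. -/
theorem LascarInvariantOver.pseudoInvariantOver (hI : IsInaccessible #U)
    (hL : lift.{w} L.card < lift.{max u v} #U) (hSat : IsSaturated L U) {A : Set U} (hA : #A < #U)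
    {n m : ℕ} {D : Set (Fin n → U)} (hD : LascarInvariantOver L A D) {S : Set (Fin m → U)}
    (hS : DefinableWith L A D S) : PseudoInvariantOver L A S := by
  intro b hb K hK hKU k
  have hU := hI.aleph0_lt
  obtain ⟨M, hM, hAM⟩ := exists_small_elementarySubstructure hU hL hA
  obtain ⟨T, hTK, hT, hTM⟩ := exists_infinite_sameType hI hL hM hKU
  obtain ⟨a, ha⟩ := hT.nonempty
  obtain ⟨f, hf, rfl⟩ := hK (hTK ha)
  -- Only `b` is known to lie in `S`, not its conjugate f b. The model is therefore pulled back
  -- along `f`: if `g` fixes `M`, then f⁻¹ g f fixes `N`, so it preserves `D` and `S`.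
  obtain ⟨N, hN⟩ := ElementarySubstructure.exists_eq_image M f.symm
  have hNU : #N < #U := by
    have : #N = #(N : Set U) := rfl
    rw [this, hN]
    exact mk_image_le.trans_lt hM
  have hAN : A ⊆ N := by
    rw [hN]
    exact fun x hx => ⟨x, hAM hx, symm_mem_autOver hf x hx⟩
  have hinv := invariantOver_iff.1 (hD N hNU hAN)
  refine ⟨{x | f.symm ∘ x ∈ S}, mem_eqClass_of_equiv f fun x => ?_, ?_⟩
  · refine iff_of_eq (congrArg (· ∈ S) (funext fun i => f.symm_apply_apply (x i)))
  · have hsub : T ⊆ K ∩ {x | f.symm ∘ x ∈ S} := fun y hy => by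
      refine ⟨hTK hy, ?_⟩
      obtain ⟨g, hg⟩ := (hTM _ ha y hy).exists_equiv hSat hU (by
        have hfin : lift.{w} #(Fin m) < #U :=
          (lift_lt_aleph0.2 (lt_aleph0_of_finite _)).trans hU
        simpa only [mk_sum, lift_uzero] using add_lt_of_lt hU.le hM hfin)
      have hh : (f.symm.comp (g.comp f)) ∈ autOver L (N : Set U) := by
        rw [hN]
        rintro _ ⟨x, hx, rfl⟩
        simpa using congrArg f.symm (hg (Sum.inl ⟨x, hx⟩))
      have hSg := (hS.mem_iff (fun x hx => hh x (hAN hx)) (hinv _ hh) b).2 hb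
      have hy' : f.symm ∘ y = f.symm.comp (g.comp f) ∘ b :=
        funext fun i => congrArg f.symm (hg (Sum.inr i)).symm
      exact (congrArg (· ∈ S) hy').mpr hSg
    exact (natCast_le_aleph0.trans (aleph0_le_mk_iff.2 hT.to_subtype)).trans
      (mk_le_mk_of_subset hsub)

theorem IsMorley.exists_equiv (hSat : IsSaturated L U) (hU : ℵ₀ < #U)
    {M : L.ElementarySubstructure U} (hM : #M < #U) {n k : ℕ} {F : Ultrafilter (Fin n → M)}
    {c d : Fin k → Fin n → U} (hc : IsMorley F c) (hd : IsMorley F d) :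
    ∃ g ∈ autOver L (M : Set U), ∀ i, g ∘ c i = d i := by
  obtain ⟨g, hg⟩ := (hc.sameType hd).exists_equiv hSat hU (by
    have hfin (k : ℕ) : lift.{w} #(Fin k) < #U :=
      (lift_lt_aleph0.2 (lt_aleph0_of_finite _)).trans hU
    simpa only [mk_sum, mk_prod, lift_uzero, lift_mul] using
      add_lt_of_lt hU.le hM (mul_lt_of_lt hU.le (hfin k) (hfin n)))
  exact ⟨g, fun a ha => hg (Sum.inl ⟨a, ha⟩), fun i => funext fun j => hg (Sum.inr (i, j))⟩

/-- If a set alternates along an indiscernible sequence then its class shatters a large set. -/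
theorem IsMorley.shatters (hSat : IsSaturated L U) (hU : ℵ₀ < #U)
    {M : L.ElementarySubstructure U} (hM : #M < #U) {n : ℕ} {F : Ultrafilter (Fin n → M)}
    {I : Type*} [LinearOrder I] [SuccOrder I] [NoMaxOrder I] {c : I → Fin n → U}
    (hc : IsMorley F c) {D D' : Set (Fin n → U)} (hD' : D' ∈ eqClass L D) {T : Finset I}
    {p : Prop} (hT : ∀ i ∈ T, (c i ∈ D' ↔ p) ∧ (c (Order.succ i) ∈ D' ↔ ¬ p)) :
    Shatters (eqClass L D) (c '' T) := by
  classical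
  intro H hH
  let e := T.orderEmbOfFin rfl
  have heT (l) : e l ∈ T := T.orderEmbOfFin_mem rfl l
  -- Of the two neighbours, exactly one belongs to `D'`; the index is chosen so that membership in
  -- `D'` agrees with the prescribed membership in `H`.
  let f (l : Fin T.card) : I := if c (e l) ∈ D' ↔ c (e l) ∈ H then e l else Order.succ (e l)
  have hfD (l) : c (f l) ∈ D' ↔ c (e l) ∈ H := by
    have := hT (e l) (heT l)
    by_cases h : c (e l) ∈ D' ↔ c (e l) ∈ H
    · simp only [f, if_pos h, h]
    · simp only [f, if_neg h]
      tauto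
  have hf : StrictMono f := by
    intro l l' hl
    have hlt : e l < e l' := e.strictMono hl
    -- The pairs {i, succ i} do not overlap: `p` is the same for all of `T`, so a point of `T`
    -- cannot be the successor of another.
    have hne : Order.succ (e l) ≠ e l' := fun h => by
      have h1 := hT _ (heT l)
      have h2 := hT _ (heT l')
      rw [← h] at h2
      tauto
    have h1 : f l ≤ Order.succ (e l) := by
      by_cases h : c (e l) ∈ D' ↔ c (e l) ∈ H
      · simpa only [f, if_pos h] using Order.le_succ _
      · simp only [f, if_neg h, le_refl]
    have h2 : e l' ≤ f l' := by
      by_cases h : c (e l') ∈ D' ↔ c (e l') ∈ H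
      · simp only [f, if_pos h, le_refl]
      · simpa only [f, if_neg h] using Order.le_succ _
    exact h1.trans_lt (((Order.succ_le_of_lt hlt).lt_of_ne hne).trans_le h2)
  obtain ⟨g, -, hg⟩ := (hc.comp hf).exists_equiv hSat hU hM (hc.comp e.strictMono)
  refine ⟨{x | g.symm ∘ x ∈ D'}, Eq.trans (mem_eqClass_of_equiv g fun x => ?_) hD', ?_⟩
  · exact iff_of_eq (congrArg (· ∈ D') (funext fun i => g.symm_apply_apply (x i)))
  · have hmem (l) : g.symm ∘ c (e l) ∈ D' ↔ c (e l) ∈ H := by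
      rw [← hfD l]
      refine iff_of_eq (congrArg (· ∈ D') (funext fun i => ?_))
      exact (congrArg g.symm (congrFun (hg l) i).symm).trans (g.symm_apply_apply _)
    have hsurj {i : I} (hi : i ∈ T) : ∃ l, e l = i := by
      have : i ∈ Set.range e := by rw [Finset.range_orderEmbOfFin]; exact hi
      exact this
    ext x
    constructor
    · rintro ⟨hx, i, hi, rfl⟩
      obtain ⟨l, rfl⟩ := hsurj hi
      exact (hmem l).1 hx
    · intro hx
      obtain ⟨i, hi, rfl⟩ := hH hx
      obtain ⟨l, rfl⟩ := hsurj hi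
      exact ⟨(hmem l).2 hx, _, hi, rfl⟩

theorem strictMono_cons_pair {I : Type*} [Preorder I] {i j : I} (h : i < j) :
    StrictMono ![i, j] := by
  intro k l hkl
  fin_cases k <;> fin_cases l <;> simp_all

theorem PseudoInvariantOver.lascarInvariantOver (hU : ℵ₀ < #U) (hSat : IsSaturated L U)
    {A : Set U} {n : ℕ} {D : Set (Fin n → U)} (hVC : FiniteVCDim (eqClass L D))
    (hD : PseudoInvariantOver L A (prodCompl D)) : LascarInvariantOver L A D := by
  classical
  intro M hM hAM
  by_contra hn
  obtain ⟨a, b, ha, hb, hab⟩ : ∃ a b, a ∈ D ∧ b ∉ D ∧ SameType L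
      (Sum.elim (fun m : M => (m : U)) a) (Sum.elim (fun m : M => (m : U)) b) := by
    simp only [invariantOver_iff, not_forall] at hn
    obtain ⟨g, hg, x, hx⟩ := hn
    have hgx : SameType L (Sum.elim (fun m : M => (m : U)) x)
        (Sum.elim (fun m : M => (m : U)) (g ∘ x)) := by
      convert sameType_equiv g (Sum.elim (fun m : M => (m : U)) x) using 1
      funext i
      rcases i with i | i
      · exact (hg i i.2).symm
      · rfl
    by_cases h : x ∈ D
    · exact ⟨x, _, h, by tauto, hgx⟩
    · exact ⟨_, x, by tauto, h, hgx.symm⟩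
  obtain ⟨F, c, hc, hac⟩ := exists_isMorley hSat hU hM hab
  let I := (#U).ord.ToType
  let _ : SuccOrder I := SuccOrder.ofLinearWellFoundedLT I
  have : NoMaxOrder I := Cardinal.noMaxOrder hU.le
  have hI : #I = #U := mk_ord_toType _
  have hpair {i j : I} (hij : i < j) : IsMorley F ![c i, c j] := by
    convert hc.comp (strictMono_cons_pair hij) using 1
    funext k
    fin_cases k <;> rfl
  -- One repetition would, by equality of types, give a = c i = b.
  have hinj' {i j : I} (hij : i < j) : c i ≠ c j := fun h => by
    have key {d : Fin n → U} (hd : IsMorley F ![d, c i]) : d = c i := by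
      funext k
      refine ((hd.sameType (hpair hij)).eq_iff (Sum.inr (0, k)) (Sum.inr (1, k))).2 ?_
      exact congrFun h k
    exact hb (key (hac i).2 ▸ key (hac i).1 ▸ ha)
  have hinj : Function.Injective c := fun i j h => by
    rcases lt_trichotomy i j with hij | hij | hij
    · exact (hinj' hij h).elim
    · exact hij
    · exact (hinj' hij h.symm).elim
  obtain ⟨N, hN⟩ := hVC
  suffices ∃ (T : Finset I) (D' : Set (Fin n → U)) (p : Prop), T.card = N ∧ D' ∈ eqClass L D ∧
      ∀ i ∈ T, (c i ∈ D' ↔ p) ∧ (c (Order.succ i) ∈ D' ↔ ¬ p) by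
    obtain ⟨T, D', p, hTN, hD', hT⟩ := this
    refine hN (T.image c) ((Finset.card_image_of_injective T hinj).trans hTN) ?_
    rw [Finset.coe_image]
    exact hc.shatters hSat hU hM hD' hT
  -- Local covering applied to κ many conjugates of a pair in D × ¬D, then enlargement of the
  -- covering set to some D' × ¬D'.
  have key (w : I → Fin (n + n) → U) (hw : Function.Injective w) (d : Fin (n + n) → U)
      (hd : d ∈ prodCompl D) (hwd : ∀ i, w i ∈ orbit L A d) :
      ∃ (T : Finset I) (D' : Set (Fin n → U)), T.card = N ∧ D' ∈ eqClass L D ∧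
        ∀ i ∈ T, w i ∈ prodCompl D' := by
    obtain ⟨C, hC, hCN⟩ := hD d hd (Set.range w) (Set.range_subset_iff.2 hwd)
      ((mk_range_eq w hw).trans hI) N
    obtain ⟨D', hD', hCD'⟩ := exists_eqClass_of_prodCompl ⟨b, hb⟩ hC
    have hsub : Set.range w ∩ C ⊆ w '' {i | w i ∈ C} := by
      rintro _ ⟨⟨i, rfl⟩, hi⟩
      exact ⟨i, hi, rfl⟩
    obtain ⟨T, hTC, hT⟩ := le_mk_iff_exists_subset.1
      ((hCN.trans (mk_le_mk_of_subset hsub)).trans mk_image_le)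
    obtain ⟨T, rfl, hTN⟩ := mk_set_eq_nat_iff_finset.1 hT
    exact ⟨T, D', hTN, hD', fun i hi => hCD' (hTC hi)⟩
  have horbit {x y x' y' : Fin n → U} (h : IsMorley F ![x, y]) (h' : IsMorley F ![x', y']) :
      ∃ g ∈ autOver L A, g ∘ x = x' ∧ g ∘ y = y' := by
    obtain ⟨g, hg, hg'⟩ := h.exists_equiv hSat hU hM h'
    exact ⟨g, fun a ha => hg a (hAM ha), hg' 0, hg' 1⟩
  have happ (g : U ≃[L] U) (x y : Fin n → U) :
      Fin.append (g ∘ x) (g ∘ y) = fun i => g (Fin.append x y i) :=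
    funext fun i => by
      refine Fin.addCases (fun i => ?_) (fun i => ?_) i
      · simp only [Fin.append_left, Function.comp_apply]
      · simp only [Fin.append_right, Function.comp_apply]
  obtain ⟨i₀⟩ : Nonempty I := mk_ne_zero_iff.1 (hI ▸ (aleph0_pos.trans hU).ne')
  by_cases h₀ : c i₀ ∈ D
  -- The halves are in reverse order: (b, c i₀) is conjugate to (c i, c (succ i)), and the half that
  -- lies in `D` must come first.
  · obtain ⟨T, D', hTN, hD', hT⟩ := key (fun i => Fin.append (c (Order.succ i)) (c i))
      (fun i j h => hinj (funext fun k => by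
        simpa only [Fin.append_right] using congrFun h (Fin.natAdd n k)))
      (Fin.append (c i₀) b) (append_mem_prodCompl.2 ⟨h₀, hb⟩) (fun i => by
        obtain ⟨g, hg, h1, h2⟩ := horbit (hac i₀).2 (hpair (Order.lt_succ i))
        exact ⟨g, hg, by rw [← happ, h1, h2]⟩)
    refine ⟨T, D', False, hTN, hD', fun i hi => ?_⟩
    have := append_mem_prodCompl.1 (hT i hi)
    tauto
  · obtain ⟨T, D', hTN, hD', hT⟩ := key (fun i => Fin.append (c i) (c (Order.succ i)))
      (fun i j h => hinj (funext fun k => by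
        simpa only [Fin.append_left] using congrFun h (Fin.castAdd n k)))
      (Fin.append a (c i₀)) (append_mem_prodCompl.2 ⟨ha, h₀⟩) (fun i => by
        obtain ⟨g, hg, h1, h2⟩ := horbit (hac i₀).1 (hpair (Order.lt_succ i))
        exact ⟨g, hg, by rw [← happ, h1, h2]⟩)
    refine ⟨T, D', True, hTN, hD', fun i hi => ?_⟩
    have := append_mem_prodCompl.1 (hT i hi)
    tauto

end Main

end PseudoInv

theorem mainTheorem6 (L : FirstOrder.Language.{u, v}) (U : Type w) [L.Structure U]
    (hInacc : Cardinal.IsInaccessible (Cardinal.mk U))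
    (hRamsey : PseudoInv.IsRamsey (Cardinal.mk U))
    (hL : Cardinal.lift.{w} L.card < Cardinal.lift.{max u v} (Cardinal.mk U))
    (hSat : PseudoInv.IsSaturated L U)
    (A : Set U) (hA : Cardinal.mk A < Cardinal.mk U)
    (n : ℕ) (D : Set (Fin n → U))
    (hVC : PseudoInv.FiniteVCDim (PseudoInv.eqClass L D)) :
    List.TFAE [
      PseudoInv.LascarInvariantOver L A D,
      ∀ (m : ℕ) (S : Set (Fin m → U)), PseudoInv.DefinableWith L A D S →
        PseudoInv.PseudoInvariantOver L A S,
      PseudoInv.PseudoInvariantOver L A (PseudoInv.prodCompl D)] := by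
  tfae_have 1 → 2 := fun h _ _ hS => h.pseudoInvariantOver hInacc hL hSat hA hS
  tfae_have 2 → 3 := fun h => h _ _ (PseudoInv.definableWith_prodCompl A D)
  tfae_have 3 → 1 := fun h => h.lascarInvariantOver hInacc.aleph0_lt hSat hVC
  tfae_finish
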